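/- There are a Borel probability measure $\nu$ on $\mathbb{R}$ with $\nu([0,1])=1$ and a nonnegative measurable function $f$ on $\mathbb{R}$ such that: 1. $\nu$ is absolutely continuous with respect to Lebesgue measure, with density $f$; 2. $\dim_L\nu>0$, where the lower Assouad dimension $\dim_L\nu$ is the supremum of the real numbers $\alpha$ for which there are $C_1,C_2>0$ such that $\nu(B(x,R))/\nu(B(x,r))\ge C_2(R/r)^{\alpha}$ for all $0<r<R\le C_1$ and all $x\in\operatorname{supp}\nu$ ($B(x,r)$ is the open ball); 3. $\nu$ is uniformly perfect: there are $a,b>0$ such that $\nu(B(z,R)\setminus B(z,aR))\ge b\,\nu(B(z,R))$ for all $z\in\operatorname{supp}\nu$ and $0<R\le 1$; 4. $f\notin L^p(\mathbb{R})$ for every $p\in(1,\infty]$. Moreover, $\nu$ can be taken of the following form. Let $K_n(x)=\sum_{j=-n}^{n}\bigl(1-\frac{|j|}{n}\bigr)e^{2\pi i jx}$ be the $n$-th Fejér kernel on $\mathbb{T}=\mathbb{R}/\mathbb{Z}$. For some sequence $N_1,N_2,\dots$ of powers $3^k$ ($k\ge1$) with $N_1=3$ and $N_{m+1}>3^{2^m}N_m$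 for all $m\ge 1$, put $g(x)=\sum_{m=1}^{\infty}m^{-2}K_{3^{2^m}}(N_mx)$. Then $\nu$ is the convolution over $\mathbb{T}$ of the measure $g(x)\,dx$ with the uniform Cantor measure on the middle-third Cantor set, regarded as a measure on $[0,1]$ and normalized to have total mass $1$. In particular, an absolutely continuous measure on $[0,1]$ with positive lower Assouad dimension need not have its density in $L^p$ for some $p>1$. -/

import Mathlib

open MeasureTheory Set
open scoped ENNReal

noncomputable section

/-- The lower Assouad dimension of a measure (meant for Borel probability measures): the supremum
of the exponents `α` for which there are `C₁, C₂ > 0` such that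
`μ (B(x,R)) / μ (B(x,r)) ≥ C₂ (R/r)^α` for all `0 < r < R ≤ C₁` and all `x ∈ supp μ`. -/
def lowerAssouadDim {X : Type*} [PseudoMetricSpace X] [MeasurableSpace X] (μ : Measure X) : EReal :=
  sSup {a : EReal | ∃ α : ℝ, a = (α : EReal) ∧ ∃ C₁ > (0 : ℝ), ∃ C₂ > (0 : ℝ),
    ∀ r R : ℝ, 0 < r → r < R → R ≤ C₁ → ∀ x ∈ μ.support,
      C₂ * (R / r) ^ α ≤ μ.real (Metric.ball x R) / μ.real (Metric.ball x r)}

/-- A measure `μ`, concentrated on the bounded set `S`, is uniformly perfect as a measure on the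
metric space `S`: for some constants `a, b > 0`, one has
`μ (B(z,R) \ B(z,aR)) ≥ b μ (B(z,R))` for all `z ∈ supp μ` and all `0 < R ≤ diam S`. -/
def IsUniformlyPerfectOn {X : Type*} [PseudoMetricSpace X] [MeasurableSpace X]
    (μ : Measure X) (S : Set X) : Prop :=
  ∃ a > (0 : ℝ), ∃ b > (0 : ℝ), ∀ z ∈ μ.support, ∀ R : ℝ, 0 < R → R ≤ Metric.diam S →
    b * μ.real (Metric.ball z R) ≤ μ.real (Metric.ball z R \ Metric.ball z (a * R))

/-- The uniform Cantor measure on the classical middle-third Cantor set: the law of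
`∑ₖ 2 εₖ / 3^(k+1)` for independent fair bits `ε₀, ε₁, …`. -/
def cantorMeasure : Measure ℝ :=
  (Measure.infinitePi fun _ : ℕ => (PMF.uniformOfFintype Bool).toMeasure).map
    fun ε => ∑' k : ℕ, (if ε k then (2 : ℝ) else 0) / 3 ^ (k + 1)

/-- The `n`-th Fejér kernel `∑_{|j| ≤ n} (1 - |j|/n) e^{2πijx}` on the circle `𝕋 = ℝ/ℤ`. -/
def fejerKernel (n : ℕ) (x : UnitAddCircle) : ℂ :=
  ∑ j ∈ Finset.Icc (-(n : ℤ)) n, (1 - ((|j| : ℤ) : ℂ) / n) * fourier j x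

/-- A sequence `N₁, N₂, …` of powers `3^k`, `k ≥ 1`, with `N₁ = 3` and `N_{m+1} > 3^(2^m) N_m`
for `m ≥ 1` (the value `N 0` is not used). -/
def IsLacunarySeq (N : ℕ → ℕ) : Prop :=
  N 1 = 3 ∧ (∀ m, 1 ≤ m → ∃ k, 1 ≤ k ∧ N m = 3 ^ k) ∧
    ∀ m, 1 ≤ m → 3 ^ 2 ^ m * N m < N (m + 1)

/-- The lacunary sum of Fejér kernels `g(x) = ∑_{m ≥ 1} m⁻² K_{3^(2^m)}(N_m x)`; the Fejér kernels
are real and nonnegative, so that the sum makes sense in `[0, ∞]`. -/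
def lacunaryFejer (N : ℕ → ℕ) (x : UnitAddCircle) : ℝ≥0∞ :=
  ∑' m : ℕ, ENNReal.ofReal
    ((fejerKernel (3 ^ 2 ^ (m + 1)) (N (m + 1) • x)).re / ((m + 1 : ℕ) : ℝ) ^ 2)

/-- The convolution over `𝕋` of the measure with density `g` and the Cantor measure. -/
def fejerCantorCircle (N : ℕ → ℕ) : Measure UnitAddCircle :=
  ((volume : Measure UnitAddCircle).withDensity (lacunaryFejer N)).conv
    (cantorMeasure.map fun x : ℝ => (x : UnitAddCircle))

/-- The same convolution, viewed as a measure on `[0,1] ⊆ ℝ` by means of the representatives in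
`[0,1)` of the points of `𝕋`. -/
def fejerCantor (N : ℕ → ℕ) : Measure ℝ :=
  (fejerCantorCircle N).map fun x => ((AddCircle.equivIco (1 : ℝ) 0 x : Ico (0 : ℝ) (0 + 1)) : ℝ)

end

/-!
The lacunary sum `g` is integrable, so its convolution with the Cantor measure is absolutely
continuous whatever the lacunary sequence is. The sequence used is `N_m = 3 ^ (2 ^ m + m - 2)`; its
rate of growth plays no role, only that its terms are powers of `3`.

*Lower Assouad dimension and uniform perfectness.* By self-similarity the Cantor measure satisfies
`16 σ (B(z,r)) ≤ σ (B(z,600r))` for small `r` and *every* centre `z`, also outside the support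
(`cantorMeasure_ball_reverse_doubling`). An inequality valid at all centres passes to the circle
with a loss of a factor `3` and, by integration, to the convolution with any measure
(`conv_circleCantor_ball_reverse_doubling`). Cutting the circle open at `0` may halve balls near
the cut, but both `g` and the Cantor measure are even, so at most another factor `2` is lost
(`ball_le_two_mul_map_icoRep`). What remains, `2 ν (B(x,r)) ≤ ν (B(x,600r))` on the support, gives
both a positive lower Assouad dimension (`lowerAssouadDim_pos`) and uniform perfectness
(`isUniformlyPerfectOn_of_reverse_doubling`).

*No higher integrability.* The map `x ↦ N_m x` of the circle preserves Lebesgue measure and, since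
`N_m` is a power of `3`, also the Cantor measure. It therefore carries the part
`m⁻² K_n(N_m x) dx * σ` of the convolution, where `n = 3 ^ M` and `M = 2 ^ m`, to `m⁻² K_n * σ`. As
`K_n ≥ n / 4` on `|x| ≤ 1 / (6n)`, the latter gives mass at least `m⁻² / 12` to a neighbourhood of
the Cantor set of Lebesgue measure at most `4 (2/3) ^ M`
(`le_fejerCantorCircle_preimage_cantorNhd`, `volume_cantorNhd_le`). By Hölder's inequality a density
in `L^p` with `p > 1` gives such sets a mass that decays exponentially in `M`
(`not_memLp_of_concentrated`).
-/

/-! ### The coding of the Cantor set -/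

/-- The law of an infinite sequence of independent fair bits. -/
noncomputable def bitMeasure : Measure (ℕ → Bool) :=
  Measure.infinitePi fun _ : ℕ => (PMF.uniformOfFintype Bool).toMeasure

instance : IsProbabilityMeasure bitMeasure := by unfold bitMeasure; infer_instance

/-- The point of the middle-third Cantor set with ternary digits `2 ε₀, 2 ε₁, …`. -/
noncomputable def cantorCoding (ε : ℕ → Bool) : ℝ :=
  ∑' k : ℕ, (if ε k then (2 : ℝ) else 0) / 3 ^ (k + 1)

/-- The sequence of bits `b, ε₀, ε₁, …`. -/
def consBit (b : Bool) (ε : ℕ → Bool) : ℕ → Bool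
  | 0 => b
  | k + 1 => ε k

lemma hasSum_two_div_three_pow : HasSum (fun k : ℕ => (2 : ℝ) / 3 ^ (k + 1)) 1 := by
  have h := (hasSum_geometric_of_lt_one (r := (1 / 3 : ℝ)) (by norm_num) (by norm_num)).mul_left
    (2 / 3)
  convert! h using 1
  · ext k
    rw [one_div, inv_pow, pow_succ]
    field_simp
  · norm_num

lemma ternaryTerm_mem_Icc (b : Bool) (k : ℕ) :
    (if b then (2 : ℝ) else 0) / 3 ^ (k + 1) ∈ Icc (0 : ℝ) (2 / 3 ^ (k + 1)) := by
  cases b <;> constructor <;> simp <;> positivity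

lemma summable_cantorCoding (ε : ℕ → Bool) :
    Summable fun k : ℕ => (if ε k then (2 : ℝ) else 0) / 3 ^ (k + 1) :=
  hasSum_two_div_three_pow.summable.of_nonneg_of_le (fun k => (ternaryTerm_mem_Icc (ε k) k).1)
    fun k => (ternaryTerm_mem_Icc (ε k) k).2

lemma cantorCoding_mem_Icc (ε : ℕ → Bool) : cantorCoding ε ∈ Icc (0 : ℝ) 1 := by
  refine ⟨tsum_nonneg fun k => (ternaryTerm_mem_Icc (ε k) k).1, ?_⟩
  rw [← hasSum_two_div_three_pow.tsum_eq]
  exact (summable_cantorCoding ε).tsum_le_tsum (fun k => (ternaryTerm_mem_Icc (ε k) k).2)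
    hasSum_two_div_three_pow.summable

lemma cantorCoding_consBit (b : Bool) (ε : ℕ → Bool) :
    cantorCoding (consBit b ε) = (cantorCoding ε + if b then 2 else 0) / 3 := by
  unfold cantorCoding
  rw [(summable_cantorCoding (consBit b ε)).tsum_eq_zero_add, add_div, add_comm, ← tsum_div_const]
  congr 1
  · refine tsum_congr fun k => ?_
    rw [consBit, pow_succ _ (k + 1), div_div]
  · cases b <;> simp [consBit]

lemma consBit_head_tail (ε : ℕ → Bool) : consBit (ε 0) (fun k => ε (k + 1)) = ε := by
  ext k; cases k <;> rfl

lemma cantorCoding_not (ε : ℕ → Bool) : cantorCoding (fun k => !ε k) = 1 - cantorCoding ε := by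
  unfold cantorCoding
  rw [← hasSum_two_div_three_pow.tsum_eq,
    ← hasSum_two_div_three_pow.summable.tsum_sub (summable_cantorCoding ε)]
  refine tsum_congr fun k => ?_
  cases h : ε k <;> simp [h]

lemma measurable_cantorCoding : Measurable cantorCoding := by
  refine Continuous.measurable (continuous_tsum (u := fun k : ℕ => (2 : ℝ) / 3 ^ (k + 1)) ?_
    hasSum_two_div_three_pow.summable ?_)
  · intro k
    exact (continuous_of_discreteTopology
      (f := fun b : Bool => (if b then (2 : ℝ) else 0) / 3 ^ (k + 1))).comp (continuous_apply k)
  · intro k ε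
    rw [Real.norm_of_nonneg (ternaryTerm_mem_Icc (ε k) k).1]
    exact (ternaryTerm_mem_Icc (ε k) k).2

lemma cantorMeasure_eq_map : cantorMeasure = bitMeasure.map cantorCoding := rfl

instance : IsProbabilityMeasure cantorMeasure := by
  rw [cantorMeasure_eq_map]
  exact Measure.isProbabilityMeasure_map measurable_cantorCoding.aemeasurable

lemma ae_cantorMeasure_mem_Icc : ∀ᵐ x ∂cantorMeasure, x ∈ Icc (0 : ℝ) 1 := by
  rw [cantorMeasure_eq_map]
  exact (ae_map_iff measurable_cantorCoding.aemeasurable measurableSet_Icc).2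
    (ae_of_all _ cantorCoding_mem_Icc)

/-! ### Symmetry and self-similarity of the Cantor measure -/

lemma coin_singleton (b : Bool) : (PMF.uniformOfFintype Bool).toMeasure {b} = 2⁻¹ := by
  rw [PMF.toMeasure_apply_singleton _ _ (measurableSet_singleton _)]
  simp

lemma coin_apply (s : Set Bool) :
    (PMF.uniformOfFintype Bool).toMeasure s = 2⁻¹ * (s.indicator 1 true + s.indicator 1 false) := by
  have h : (PMF.uniformOfFintype Bool).toMeasure =
      (2⁻¹ : ℝ≥0∞) • (Measure.dirac true + Measure.dirac false) := by
    refine Measure.ext_of_singleton fun b => ?_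
    rw [coin_singleton]
    cases b <;> simp
  rw [h]
  simp [mul_add]

lemma measurable_consBit (b : Bool) : Measurable (consBit b) := by
  refine measurable_pi_iff.2 fun k => ?_
  cases k
  · exact measurable_const
  · exact measurable_pi_apply _

lemma measurable_notBits : Measurable fun (ε : ℕ → Bool) k => !ε k :=
  measurable_pi_iff.2 fun k => (measurable_of_countable Bool.not).comp (measurable_pi_apply k)

lemma map_notBits_bitMeasure : bitMeasure.map (fun ε k => !ε k) = bitMeasure := by
  refine Measure.eq_infinitePi _ fun s t ht => ?_
  rw [Measure.map_apply measurable_notBits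
    (MeasurableSet.pi s.countable_toSet fun i _ => ht i)]
  have : (fun (ε : ℕ → Bool) k => !ε k) ⁻¹' (s : Set ℕ).pi t =
      (s : Set ℕ).pi fun i => Bool.not ⁻¹' t i := by
    ext ε; simp [Set.mem_pi]
  rw [this, bitMeasure, Measure.infinitePi_pi _ fun i _ => measurable_of_countable _ (ht i)]
  refine Finset.prod_congr rfl fun i _ => ?_
  rw [coin_apply, coin_apply, add_comm]
  rfl

lemma bitMeasure_eq_map_consBit :
    bitMeasure = (2⁻¹ : ℝ≥0∞) • (bitMeasure.map (consBit true) + bitMeasure.map (consBit false)) := by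
  symm
  refine Measure.eq_infinitePi _ fun s t ht => ?_
  have hm : MeasurableSet ((s : Set ℕ).pi t) :=
    MeasurableSet.pi s.countable_toSet fun i _ => ht i
  classical
  set s' : Finset ℕ := s.preimage Nat.succ Nat.succ_injective.injOn with hs'
  have key (b : Bool) : bitMeasure (consBit b ⁻¹' (s : Set ℕ).pi t) =
      (if 0 ∈ s then (t 0).indicator 1 b else 1) *
        ∏ i ∈ s', (PMF.uniformOfFintype Bool).toMeasure (t (i + 1)) := by
    by_cases hb : 0 ∈ s → b ∈ t 0
    · have : consBit b ⁻¹' (s : Set ℕ).pi t = (s' : Set ℕ).pi fun i => t (i + 1) := by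
        ext ε
        simp only [mem_preimage, Set.mem_pi, Finset.mem_coe, hs', Finset.mem_preimage]
        refine ⟨fun h i hi => h (i + 1) hi, fun h i hi => ?_⟩
        cases i
        · exact hb hi
        · exact h _ hi
      rw [this, bitMeasure, Measure.infinitePi_pi _ fun i _ => ht _]
      by_cases h0 : 0 ∈ s
      · simp [h0, hb h0]
      · simp [h0]
    · push Not at hb
      have : consBit b ⁻¹' (s : Set ℕ).pi t = ∅ := by
        ext ε
        simp only [mem_preimage, Set.mem_pi, Finset.mem_coe, mem_empty_iff_false, iff_false]
        exact fun h => hb.2 (h 0 hb.1)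
      rw [this]
      simp [hb.1, hb.2]
  rw [Measure.smul_apply, Measure.add_apply, Measure.map_apply (measurable_consBit _) hm,
    Measure.map_apply (measurable_consBit _) hm, key, key, ← add_mul, smul_eq_mul, ← mul_assoc]
  have hsplit : ∏ i ∈ s, (PMF.uniformOfFintype Bool).toMeasure (t i) =
      (if 0 ∈ s then (PMF.uniformOfFintype Bool).toMeasure (t 0) else 1) *
        ∏ i ∈ s', (PMF.uniformOfFintype Bool).toMeasure (t (i + 1)) := by
    have h1 : ∏ i ∈ s', (PMF.uniformOfFintype Bool).toMeasure (t (i + 1)) =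
        ∏ i ∈ s with i ≠ 0, (PMF.uniformOfFintype Bool).toMeasure (t i) := by
      refine Finset.prod_bij (fun i _ => i + 1) ?_ ?_ ?_ ?_
      · intro i hi; simpa [hs'] using hi
      · intro i _ j _ h; simpa using h
      · intro i hi
        obtain ⟨hi, h0⟩ := Finset.mem_filter.1 hi
        obtain ⟨j, rfl⟩ := Nat.exists_eq_succ_of_ne_zero h0
        exact ⟨j, by simpa [hs'] using hi, rfl⟩
      · intro i _; rfl
    rw [h1, ← Finset.prod_filter_mul_prod_filter_not s (fun i => i = 0), Finset.filter_eq']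
    congr 1
    split_ifs <;> simp
  rw [hsplit]
  congr 1
  split_ifs
  · rw [coin_apply]
  · rw [one_add_one_eq_two, ENNReal.inv_mul_cancel two_ne_zero ENNReal.ofNat_ne_top]

/-- The self-similarity of the Cantor measure under the contractions `x ↦ x / 3` and
`x ↦ (x + 2) / 3`. -/
lemma cantorMeasure_apply_eq {A : Set ℝ} (hA : MeasurableSet A) :
    cantorMeasure A = 2⁻¹ * (cantorMeasure ((fun x => (x + 2) / 3) ⁻¹' A) +
      cantorMeasure ((fun x => x / 3) ⁻¹' A)) := by
  have hA' := measurable_cantorCoding hA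
  have h2 : Measurable fun x : ℝ => (x + 2) / 3 := by fun_prop
  have h0 : Measurable fun x : ℝ => x / 3 := by fun_prop
  rw [cantorMeasure_eq_map, Measure.map_apply measurable_cantorCoding hA,
    Measure.map_apply measurable_cantorCoding (h2 hA),
    Measure.map_apply measurable_cantorCoding (h0 hA)]
  conv_lhs => rw [bitMeasure_eq_map_consBit]
  rw [Measure.smul_apply, Measure.add_apply, Measure.map_apply (measurable_consBit _) hA',
    Measure.map_apply (measurable_consBit _) hA', smul_eq_mul]
  congr 3 <;> ext ε <;> simp [cantorCoding_consBit]

lemma map_one_sub_cantorMeasure : cantorMeasure.map (fun x => 1 - x) = cantorMeasure := by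
  rw [cantorMeasure_eq_map, Measure.map_map (by fun_prop) measurable_cantorCoding]
  conv_rhs => rw [← map_notBits_bitMeasure,
    Measure.map_map measurable_cantorCoding measurable_notBits]
  congr 1
  ext ε
  simp [cantorCoding_not]

/-! ### Reverse doubling of the Cantor measure -/

lemma cantorMeasure_ball_eq_zero {z r : ℝ} (h : Disjoint (Metric.ball z r) (Icc 0 1)) :
    cantorMeasure (Metric.ball z r) = 0 :=
  measure_mono_null h.subset_compl_right ae_cantorMeasure_mem_Icc

/-- A ball of radius at most `1 / 6` meets only one of the two similar halves of the Cantor set, so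
that its mass is half that of the magnified ball. -/
lemma exists_cantorMeasure_ball_eq (z : ℝ) {r : ℝ} (hr : r ≤ 1 / 6) :
    ∃ w : ℝ, cantorMeasure (Metric.ball z r) = 2⁻¹ * cantorMeasure (Metric.ball w (3 * r)) ∧
      ∀ R, 2⁻¹ * cantorMeasure (Metric.ball w (3 * R)) ≤ cantorMeasure (Metric.ball z R) := by
  have h2 (R : ℝ) : (fun x : ℝ => (x + 2) / 3) ⁻¹' Metric.ball z R =
      Metric.ball (3 * z - 2) (3 * R) := by
    ext x
    simp only [mem_preimage, Metric.mem_ball, Real.dist_eq, abs_lt]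
    constructor <;> rintro ⟨h, h'⟩ <;> constructor <;> linarith
  have h0 (R : ℝ) : (fun x : ℝ => x / 3) ⁻¹' Metric.ball z R =
      Metric.ball (3 * z) (3 * R) := by
    ext x
    simp only [mem_preimage, Metric.mem_ball, Real.dist_eq, abs_lt]
    constructor <;> rintro ⟨h, h'⟩ <;> constructor <;> linarith
  have key (R : ℝ) : cantorMeasure (Metric.ball z R) =
      2⁻¹ * (cantorMeasure (Metric.ball (3 * z - 2) (3 * R)) +
        cantorMeasure (Metric.ball (3 * z) (3 * R))) := by
    rw [cantorMeasure_apply_eq measurableSet_ball, h2, h0]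
  rcases le_or_gt z (1 / 2) with hz | hz
  · refine ⟨3 * z, ?_, fun R => ?_⟩
    · rw [key, cantorMeasure_ball_eq_zero (z := 3 * z - 2), zero_add]
      refine disjoint_left.2 fun x hx hx' => ?_
      rw [Metric.mem_ball, Real.dist_eq, abs_lt] at hx
      linarith [hx'.1]
    · rw [key]
      gcongr
      exact le_add_self
  · refine ⟨3 * z - 2, ?_, fun R => ?_⟩
    · rw [key, cantorMeasure_ball_eq_zero (z := 3 * z), add_zero]
      refine disjoint_left.2 fun x hx hx' => ?_
      rw [Metric.mem_ball, Real.dist_eq, abs_lt] at hx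
      linarith [hx'.2]
    · rw [key]
      gcongr
      exact le_self_add

lemma two_mul_inv_two_mul (a : ℝ≥0∞) : 2 * (2⁻¹ * a) = a := by
  rw [← mul_assoc, ENNReal.mul_inv_cancel two_ne_zero ENNReal.ofNat_ne_top, one_mul]

lemma two_pow_mul_cantorMeasure_ball_le (n : ℕ) (z : ℝ) {r : ℝ} (hr : 3 ^ n * r ≤ 1 / 2) :
    2 ^ n * cantorMeasure (Metric.ball z r) ≤ 1 := by
  induction n generalizing z r with
  | zero => simpa using prob_le_one
  | succ n ih =>
    rcases le_or_gt r 0 with h0 | h0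
    · simp [Metric.ball_eq_empty.2 h0]
    have h3 : (1 : ℝ) ≤ 3 ^ n := one_le_pow₀ (by norm_num)
    have hr' : 3 ^ n * (3 * r) ≤ 1 / 2 := by rw [pow_succ] at hr; linarith
    obtain ⟨w, hw, -⟩ := exists_cantorMeasure_ball_eq z (r := r) (by nlinarith)
    rw [hw, pow_succ, mul_assoc, two_mul_inv_two_mul]
    exact ih w hr'

/-- Reverse doubling of the Cantor measure at every point of the line, in the support or not. -/
lemma cantorMeasure_ball_reverse_doubling (z : ℝ) {r : ℝ} (hr0 : 0 < r) (hr : r ≤ 1 / 162) :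
    16 * cantorMeasure (Metric.ball z r) ≤ cantorMeasure (Metric.ball z (600 * r)) := by
  -- As `162 = 2 * 3 ^ 4`, balls of radius at most `1 / 162` have mass at most `1 / 16`. If moreover
  -- `r ≥ 1 / 486`, then `600 r > 1 + r`, so that the large ball has full mass as soon as the small
  -- one meets `[0, 1]`. Smaller scales reduce to these by magnification.
  have base (z r : ℝ) (hr0 : 1 / 486 ≤ r) (hr : r ≤ 1 / 162) :
      16 * cantorMeasure (Metric.ball z r) ≤ cantorMeasure (Metric.ball z (600 * r)) := by
    by_cases h : Disjoint (Metric.ball z r) (Icc 0 1)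
    · simp [cantorMeasure_ball_eq_zero h]
    obtain ⟨w, hw, hw'⟩ := not_disjoint_iff.1 h
    have h1 : cantorMeasure (Metric.ball z (600 * r)) = 1 := by
      refine (mem_ae_iff_prob_eq_one measurableSet_ball).1 ?_
      filter_upwards [ae_cantorMeasure_mem_Icc] with y hy
      rw [Metric.mem_ball, Real.dist_eq, abs_lt] at hw ⊢
      constructor <;> linarith [hw'.1, hw'.2, hy.1, hy.2]
    rw [h1]
    have := two_pow_mul_cantorMeasure_ball_le 4 z (r := r) (by linarith)
    norm_num at this ⊢
    exact this
  have step (j : ℕ) (z r : ℝ) (hr0 : 1 / 486 ≤ 3 ^ j * r) (hr : r ≤ 1 / 162) :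
      16 * cantorMeasure (Metric.ball z r) ≤ cantorMeasure (Metric.ball z (600 * r)) := by
    induction j generalizing z r with
    | zero => exact base z r (by simpa using hr0) hr
    | succ j ih =>
      rcases le_or_gt (1 / 486) r with h | h
      · exact base z r h hr
      obtain ⟨w, hw, hw'⟩ := exists_cantorMeasure_ball_eq z (r := r) (by linarith)
      have := ih w (3 * r) (by rw [pow_succ] at hr0; linarith) (by linarith)
      rw [hw]
      refine le_trans ?_ (hw' (600 * r))
      rw [mul_left_comm]
      gcongr
      convert! this using 3
      ring
  obtain ⟨j, hj⟩ := pow_unbounded_of_one_lt (1 / 486 / r) (by norm_num : (1 : ℝ) < 3)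
  exact step j z r ((div_lt_iff₀ hr0).1 hj).le hr

/-! ### The Cantor measure on the circle and its convolutions -/

/-- The Cantor measure on the circle `ℝ / ℤ`. -/
noncomputable def circleCantor : Measure UnitAddCircle :=
  cantorMeasure.map fun x : ℝ => (x : UnitAddCircle)

instance : IsProbabilityMeasure circleCantor :=
  Measure.isProbabilityMeasure_map AddCircle.measurable_mk'.aemeasurable

lemma circleCantor_apply {A : Set UnitAddCircle} (hA : MeasurableSet A) :
    circleCantor A = cantorMeasure ((fun x : ℝ => (x : UnitAddCircle)) ⁻¹' A) :=
  Measure.map_apply AddCircle.measurable_mk' hA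

lemma circleCantor_ball_reverse_doubling (z : UnitAddCircle) {r : ℝ} (hr0 : 0 < r)
    (hr : r ≤ 1 / 162) :
    16 * circleCantor (Metric.ball z r) ≤ 3 * circleCantor (Metric.ball z (600 * r)) := by
  obtain ⟨s, ⟨hs0, hs1⟩, rfl⟩ := AddCircle.eq_coe_Ico z
  rw [circleCantor_apply measurableSet_ball, circleCantor_apply measurableSet_ball]
  have hmem (t R : ℝ) : t ∈ (fun x : ℝ => (x : UnitAddCircle)) ⁻¹'
      Metric.ball (s : UnitAddCircle) R ↔ |t - s - round (t - s)| < R := by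
    rw [mem_preimage, Metric.mem_ball, dist_eq_norm, ← AddCircle.coe_sub, UnitAddCircle.norm_eq]
  have hle : cantorMeasure ((fun x : ℝ => (x : UnitAddCircle)) ⁻¹'
      Metric.ball (s : UnitAddCircle) r) ≤ cantorMeasure (Metric.ball (s - 1) r) +
        cantorMeasure (Metric.ball s r) + cantorMeasure (Metric.ball (s + 1) r) := by
    refine le_trans (measure_mono_ae ?_) ((measure_union_le _ _).trans
      (add_le_add_left (measure_union_le _ _) _))
    filter_upwards [ae_cantorMeasure_mem_Icc] with t ht h
    have h := (hmem t r).1 h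
    rw [abs_lt] at h
    have h1 : round (t - s) < 2 := by
      have : (round (t - s) : ℝ) < (2 : ℤ) := by push_cast; linarith [ht.2]
      exact_mod_cast this
    have h2 : -2 < round (t - s) := by
      have : ((-2 : ℤ) : ℝ) < round (t - s) := by push_cast; linarith [ht.1]
      exact_mod_cast this
    change t ∈ Metric.ball (s - 1) r ∪ Metric.ball s r ∪ Metric.ball (s + 1) r
    simp only [mem_union, Metric.mem_ball, Real.dist_eq, abs_lt]
    generalize round (t - s) = k at *
    obtain rfl | rfl | rfl : k = -1 ∨ k = 0 ∨ k = 1 := by omega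
    · left; left; push_cast at h; constructor <;> linarith
    · left; right; push_cast at h; constructor <;> linarith
    · right; push_cast at h; constructor <;> linarith
  have hge (k : ℤ) : cantorMeasure (Metric.ball (s + k) (600 * r)) ≤
      cantorMeasure ((fun x : ℝ => (x : UnitAddCircle)) ⁻¹'
        Metric.ball (s : UnitAddCircle) (600 * r)) := by
    refine measure_mono fun t ht => (hmem t _).2 ((round_le (t - s) k).trans_lt ?_)
    rwa [Metric.mem_ball, Real.dist_eq, ← sub_sub] at ht
  have e := hge (-1)
  have e0 := hge 0
  have e1 := hge 1
  push_cast at e e0 e1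
  rw [← sub_eq_add_neg] at e
  rw [add_zero] at e0
  calc _ ≤ 16 * (cantorMeasure (Metric.ball (s - 1) r) +
        cantorMeasure (Metric.ball s r) + cantorMeasure (Metric.ball (s + 1) r)) := by gcongr
    _ = 16 * cantorMeasure (Metric.ball (s - 1) r) + 16 * cantorMeasure (Metric.ball s r) +
        16 * cantorMeasure (Metric.ball (s + 1) r) := by ring
    _ ≤ _ := add_le_add (add_le_add ((cantorMeasure_ball_reverse_doubling _ hr0 hr).trans e)
        ((cantorMeasure_ball_reverse_doubling _ hr0 hr).trans e0))
        ((cantorMeasure_ball_reverse_doubling _ hr0 hr).trans e1)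
    _ = _ := by ring

lemma conv_apply {G : Type*} [AddMonoid G] [MeasurableSpace G] [MeasurableAdd₂ G]
    (μ ν : Measure G) [SFinite ν] {A : Set G} (hA : MeasurableSet A) :
    μ.conv ν A = ∫⁻ x, ν ((fun y => x + y) ⁻¹' A) ∂μ := by
  rw [Measure.conv, Measure.map_apply measurable_add hA, Measure.prod_apply (measurable_add hA)]
  rfl

lemma preimage_const_add_metric_ball {G : Type*} [SeminormedAddCommGroup G] (x z : G) (r : ℝ) :
    (fun y => x + y) ⁻¹' Metric.ball z r = Metric.ball (z - x) r := by
  ext y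
  rw [mem_preimage, Metric.mem_ball, Metric.mem_ball, dist_eq_norm, dist_eq_norm]
  congr! 2
  abel

/-- Since reverse doubling of the Cantor measure holds with every centre, it is inherited by the
convolution with any measure. -/
lemma conv_circleCantor_ball_reverse_doubling (μ : Measure UnitAddCircle) (z : UnitAddCircle)
    {r : ℝ} (hr0 : 0 < r) (hr : r ≤ 1 / 162) :
    16 * μ.conv circleCantor (Metric.ball z r) ≤
      3 * μ.conv circleCantor (Metric.ball z (600 * r)) := by
  rw [conv_apply _ _ measurableSet_ball, conv_apply _ _ measurableSet_ball,
    ← lintegral_const_mul' _ _ (by simp), ← lintegral_const_mul' _ _ (by simp)]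
  refine lintegral_mono fun x => ?_
  simp only [preimage_const_add_metric_ball]
  exact circleCantor_ball_reverse_doubling _ hr0 hr

lemma map_neg_circleCantor : circleCantor.map (fun x => -x) = circleCantor := by
  rw [circleCantor, Measure.map_map (by fun_prop) AddCircle.measurable_mk']
  conv_rhs => rw [← map_one_sub_cantorMeasure,
    Measure.map_map AddCircle.measurable_mk' (by fun_prop)]
  congr 1
  ext x
  simp [AddCircle.coe_period]

lemma map_three_nsmul_circleCantor : circleCantor.map (fun x => 3 • x) = circleCantor := by
  have h3 : Measurable fun x : UnitAddCircle => 3 • x := (continuous_nsmul 3).measurable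
  ext A hA
  have hA' := AddCircle.measurable_mk' hA
  rw [Measure.map_apply h3 hA, circleCantor_apply (h3 hA), circleCantor_apply hA,
    cantorMeasure_apply_eq (AddCircle.measurable_mk' (h3 hA))]
  have e2 : (fun x : ℝ => (x + 2) / 3) ⁻¹' ((fun x : ℝ => (x : UnitAddCircle)) ⁻¹'
      ((fun x : UnitAddCircle => 3 • x) ⁻¹' A)) = (fun x : ℝ => (x : UnitAddCircle)) ⁻¹' A := by
    ext x
    have : (3 • (((x + 2) / 3 : ℝ) : UnitAddCircle)) = (x : UnitAddCircle) := by
      rw [← AddCircle.coe_nsmul, nsmul_eq_mul]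
      have : ((3 : ℕ) : ℝ) * ((x + 2) / 3) = x + 1 + 1 := by push_cast; ring
      rw [this, AddCircle.coe_add, AddCircle.coe_add, AddCircle.coe_period, add_zero, add_zero]
    simp only [mem_preimage, this]
  have e0 : (fun x : ℝ => x / 3) ⁻¹' ((fun x : ℝ => (x : UnitAddCircle)) ⁻¹'
      ((fun x : UnitAddCircle => 3 • x) ⁻¹' A)) = (fun x : ℝ => (x : UnitAddCircle)) ⁻¹' A := by
    ext x
    have : (3 • ((x / 3 : ℝ) : UnitAddCircle)) = (x : UnitAddCircle) := by
      rw [← AddCircle.coe_nsmul, nsmul_eq_mul]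
      congr 1
      push_cast; ring
    simp only [mem_preimage, this]
  rw [e2, e0, ← two_mul, mul_left_comm, two_mul_inv_two_mul]

lemma measurePreserving_three_pow_nsmul_circleCantor (k : ℕ) :
    MeasurePreserving (fun x : UnitAddCircle => 3 ^ k • x) circleCantor circleCantor := by
  induction k with
  | zero => simpa using! MeasurePreserving.id circleCantor
  | succ k ih =>
    have h3 : MeasurePreserving (fun x : UnitAddCircle => 3 • x) circleCantor circleCantor :=
      ⟨(continuous_nsmul 3).measurable, map_three_nsmul_circleCantor⟩
    convert! h3.comp ih using 2 with x
    rw [Function.comp_apply, smul_smul, pow_succ']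

/-! ### Reverse doubling, lower Assouad dimension and uniform perfectness -/

section ReverseDoubling

variable {X : Type*} [PseudoMetricSpace X] [MeasurableSpace X] {μ : Measure X}
  {A r₀ : ℝ}

lemma two_pow_mul_measureReal_ball_le (hA : 1 < A) {x : X}
    (h : ∀ r : ℝ, 0 < r → r ≤ r₀ →
      2 * μ.real (Metric.ball x r) ≤ μ.real (Metric.ball x (A * r)))
    (k : ℕ) {r : ℝ} (hr : 0 < r) (hk : A ^ k * r ≤ r₀) :
    2 ^ k * μ.real (Metric.ball x r) ≤ μ.real (Metric.ball x (A ^ k * r)) := by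
  induction k with
  | zero => simp
  | succ k ih =>
    have hpos : 0 < A ^ k * r := by positivity
    have hk' : A ^ k * r ≤ r₀ := by
      refine le_trans ?_ hk
      rw [pow_succ', mul_assoc]
      exact le_mul_of_one_le_left hpos.le hA.le
    calc 2 ^ (k + 1) * μ.real (Metric.ball x r)
        = 2 * (2 ^ k * μ.real (Metric.ball x r)) := by ring
      _ ≤ 2 * μ.real (Metric.ball x (A ^ k * r)) := by gcongr; exact ih hk'
      _ ≤ μ.real (Metric.ball x (A * (A ^ k * r))) := h _ hpos hk'
      _ = _ := by rw [← mul_assoc, ← pow_succ']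

variable [IsFiniteMeasure μ]

/-- Doubling the mass whenever the radius grows by a factor `A` gives the exponent
`log 2 / log A`. -/
lemma lowerAssouadDim_pos (hA : 1 < A) (hr₀ : 0 < r₀)
    (h : ∀ x ∈ μ.support, ∀ r : ℝ, 0 < r → r ≤ r₀ →
      2 * μ.real (Metric.ball x r) ≤ μ.real (Metric.ball x (A * r))) :
    0 < lowerAssouadDim μ := by
  have hα : 0 < Real.logb A 2 := Real.logb_pos hA one_lt_two
  have hpow : A ^ Real.logb A 2 = 2 := Real.rpow_logb (by linarith) hA.ne' two_pos
  refine lt_of_lt_of_le (EReal.coe_pos.2 hα) (le_sSup ⟨_, rfl, r₀, hr₀, 1 / 2, by norm_num, ?_⟩)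
  intro r R hr hrR hR x hx
  have hpos : 0 < μ.real (Metric.ball x r) :=
    ENNReal.toReal_pos ((Measure.mem_support_iff_forall x).1 hx _ (Metric.ball_mem_nhds x hr)).ne'
      (measure_ne_top _ _)
  obtain ⟨k, hk, hk'⟩ := exists_nat_pow_near ((one_le_div hr).2 hrR.le) hA
  rw [le_div_iff₀ hr] at hk
  have h1 : (R / r) ^ Real.logb A 2 ≤ 2 ^ (k + 1) := by
    calc (R / r) ^ Real.logb A 2 ≤ (A ^ (k + 1)) ^ Real.logb A 2 :=
          Real.rpow_le_rpow (div_nonneg (hr.trans hrR).le hr.le) hk'.le hα.le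
      _ = 2 ^ (k + 1) := by rw [← Real.rpow_pow_comm (by linarith), hpow]
  rw [le_div_iff₀ hpos]
  calc 1 / 2 * (R / r) ^ Real.logb A 2 * μ.real (Metric.ball x r)
      ≤ 1 / 2 * 2 ^ (k + 1) * μ.real (Metric.ball x r) := by gcongr
    _ = 2 ^ k * μ.real (Metric.ball x r) := by ring
    _ ≤ μ.real (Metric.ball x (A ^ k * r)) :=
        two_pow_mul_measureReal_ball_le hA (h x hx) k hr (hk.trans hR)
    _ ≤ μ.real (Metric.ball x R) := measureReal_mono (Metric.ball_subset_ball hk)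

lemma isUniformlyPerfectOn_of_reverse_doubling (hA : 1 < A) (hr₀ : 0 < r₀)
    (h : ∀ x ∈ μ.support, ∀ r : ℝ, 0 < r → r ≤ r₀ →
      2 * μ.real (Metric.ball x r) ≤ μ.real (Metric.ball x (A * r))) (S : Set X) :
    IsUniformlyPerfectOn μ S := by
  have hd : 0 < Metric.diam S + 1 := by linarith [Metric.diam_nonneg (s := S)]
  have hA0 : 0 < A := one_pos.trans hA
  have ha : 0 < min (r₀ / (Metric.diam S + 1)) (1 / A) := by positivity
  refine ⟨_, ha, 1 / 2, by norm_num, fun z hz R hR hRS => ?_⟩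
  set a := min (r₀ / (Metric.diam S + 1)) (1 / A)
  have h1 : a * R ≤ r₀ := by
    calc a * R ≤ r₀ / (Metric.diam S + 1) * (Metric.diam S + 1) := by
          gcongr
          · exact min_le_left _ _
          · linarith
      _ = r₀ := div_mul_cancel₀ _ hd.ne'
  have h2 : A * (a * R) ≤ R := by
    calc A * (a * R) ≤ A * (1 / A * R) := by gcongr; exact min_le_right _ _
      _ = R := by field_simp
  have h3 := (h z hz (a * R) (by positivity) h1).trans
    (measureReal_mono (Metric.ball_subset_ball h2))
  have h4 : μ.real (Metric.ball z R) ≤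
      μ.real (Metric.ball z R \ Metric.ball z (a * R)) + μ.real (Metric.ball z (a * R)) := by
    refine le_trans (measureReal_mono ?_) (measureReal_union_le _ _)
    rw [sdiff_union_self]
    exact subset_union_left
  linarith

end ReverseDoubling

/-! ### Cutting the circle open at the origin -/

/-- The representative in `[0, 1)` of a point of the circle. -/
noncomputable def icoRep (x : UnitAddCircle) : ℝ :=
  ((AddCircle.equivIco (1 : ℝ) 0 x : Ico (0 : ℝ) (0 + 1)) : ℝ)

lemma measurable_icoRep : Measurable icoRep :=
  measurable_subtype_coe.comp (AddCircle.measurableEquivIco (1 : ℝ) 0).measurable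

lemma icoRep_mem (x : UnitAddCircle) : icoRep x ∈ Ico (0 : ℝ) 1 := by
  simpa only [zero_add] using! (AddCircle.equivIco (1 : ℝ) 0 x).2

lemma coe_icoRep (x : UnitAddCircle) : ((icoRep x : ℝ) : UnitAddCircle) = x :=
  AddCircle.coe_equivIco

lemma icoRep_coe {t : ℝ} (ht : t ∈ Ico (0 : ℝ) 1) : icoRep (t : UnitAddCircle) = t :=
  AddCircle.equivIco_coe_of_mem (by rwa [zero_add])

lemma map_icoRep_ball_le (μ : Measure UnitAddCircle) (s r : ℝ) :
    μ.map icoRep (Metric.ball s r) ≤ μ (Metric.ball (s : UnitAddCircle) r) := by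
  rw [Measure.map_apply measurable_icoRep measurableSet_ball]
  refine measure_mono fun x hx => ?_
  rw [mem_preimage, Metric.mem_ball, Real.dist_eq] at hx
  rw [Metric.mem_ball, dist_eq_norm, ← coe_icoRep x, ← AddCircle.coe_sub, UnitAddCircle.norm_eq]
  refine (round_le _ 0).trans_lt ?_
  simpa using hx

/-- For a measure on the circle without mass at the cut and invariant under `x ↦ -x`, a ball of the
circle that is cut into two pieces has at most twice the mass of the piece near its centre, because
the reflection of the other piece lies near the centre as well. -/
lemma ball_le_two_mul_map_icoRep (μ : Measure UnitAddCircle) (h0 : μ {0} = 0)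
    (hneg : μ.map (fun x => -x) = μ) {s : ℝ} (hs : s ∈ Icc (0 : ℝ) 1) (R : ℝ) :
    μ (Metric.ball (s : UnitAddCircle) R) ≤ 2 * μ.map icoRep (Metric.ball s R) := by
  rw [Measure.map_apply measurable_icoRep measurableSet_ball]
  set U := icoRep ⁻¹' Metric.ball s R
  have hU : MeasurableSet U := measurable_icoRep measurableSet_ball
  have hV : μ ((fun x => -x) ⁻¹' U) = μ U := by
    rw [← Measure.map_apply measurable_neg hU, hneg]
  calc μ (Metric.ball (s : UnitAddCircle) R) ≤ μ (U ∪ (fun x => -x) ⁻¹' U) := by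
        refine measure_mono_ae ?_
        have h0' : ∀ᵐ x ∂μ, x ≠ 0 := by
          rw [ae_iff]
          simpa using h0
        filter_upwards [h0'] with x hx0 hx
        obtain ⟨ht0, ht1⟩ := icoRep_mem x
        have hxt := coe_icoRep x
        have hU' : x ∈ U ↔ |icoRep x - s| < R := by
          rw [mem_preimage, Metric.mem_ball, Real.dist_eq]
        set t := icoRep x
        have ht0' : 0 < t := by
          refine lt_of_le_of_ne ht0 fun h => hx0 ?_
          rw [← hxt, ← h, AddCircle.coe_zero]
        have hV' : x ∈ (fun x => -x) ⁻¹' U ↔ |1 - t - s| < R := by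
          have : -x = ((1 - t : ℝ) : UnitAddCircle) := by
            rw [AddCircle.coe_sub, AddCircle.coe_period, zero_sub, hxt]
          rw [mem_preimage, mem_preimage, this, icoRep_coe ⟨by linarith, by linarith⟩,
            Metric.mem_ball, Real.dist_eq]
        change x ∈ U ∪ (fun x => -x) ⁻¹' U
        rw [mem_union, hU', hV']
        have hx : x ∈ Metric.ball (s : UnitAddCircle) R := hx
        rw [Metric.mem_ball, dist_eq_norm, ← hxt, ← AddCircle.coe_sub, UnitAddCircle.norm_eq] at hx
        have hhalf := abs_le.1 (abs_sub_round (t - s))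
        have h1 : round (t - s) < 2 := by
          have : (round (t - s) : ℝ) < (2 : ℤ) := by push_cast; linarith [hs.1]
          exact_mod_cast this
        have h2 : -2 < round (t - s) := by
          have : ((-2 : ℤ) : ℝ) < round (t - s) := by push_cast; linarith [hs.2]
          exact_mod_cast this
        generalize round (t - s) = k at *
        rw [abs_lt] at hx
        obtain rfl | rfl | rfl : k = -1 ∨ k = 0 ∨ k = 1 := by omega
        · right; push_cast at hx; rw [abs_lt]; constructor <;> linarith [hs.1, hs.2]
        · left; push_cast at hx; rw [abs_lt]; constructor <;> linarith
        · right; push_cast at hx; rw [abs_lt]; constructor <;> linarith [hs.1, hs.2]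
    _ ≤ μ U + μ U := (measure_union_le _ _).trans_eq (by rw [hV])
    _ = 2 * μ U := (two_mul _).symm

lemma map_icoRep_absolutelyContinuous {μ : Measure UnitAddCircle} (h : μ ≪ volume) :
    μ.map icoRep ≪ volume := by
  refine (h.map measurable_icoRep).trans ?_
  refine Measure.AbsolutelyContinuous.mk fun A hA hA0 => ?_
  rw [Measure.map_apply measurable_icoRep hA, ← (UnitAddCircle.measurePreserving_mk 0).map_eq,
    Measure.map_apply AddCircle.measurable_mk' (measurable_icoRep hA),
    Measure.restrict_apply (AddCircle.measurable_mk' (measurable_icoRep hA))]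
  refine measure_mono_null (t := A ∪ {1}) (fun t ht => ?_)
    (measure_union_null hA0 (measure_singleton _))
  obtain ⟨htA, ht0, ht1⟩ := ht
  rw [zero_add] at ht1
  rcases ht1.eq_or_lt with rfl | ht1
  · exact Or.inr rfl
  · left
    rwa [mem_preimage, mem_preimage, icoRep_coe ⟨ht0.le, ht1⟩] at htA

lemma volume_Ico_inter_coe_preimage_le {E : Set UnitAddCircle} (hE : MeasurableSet E) :
    volume (Ico (0 : ℝ) 1 ∩ (fun t : ℝ => (t : UnitAddCircle)) ⁻¹' E) ≤ volume E := by
  have hm := AddCircle.measurable_mk' hE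
  rw [← (UnitAddCircle.measurePreserving_mk 0).map_eq, Measure.map_apply AddCircle.measurable_mk' hE,
    Measure.restrict_apply hm]
  have : Ico (0 : ℝ) 1 ∩ (fun t : ℝ => (t : UnitAddCircle)) ⁻¹' E ⊆
      {0} ∪ ((fun t : ℝ => (t : UnitAddCircle)) ⁻¹' E ∩ Ioc (0 : ℝ) (0 + 1)) := by
    rintro t ⟨⟨ht0, ht1⟩, htE⟩
    rcases ht0.eq_or_lt with rfl | ht0
    · exact Or.inl rfl
    · exact Or.inr ⟨htE, ht0, by linarith⟩
  refine (measure_mono this).trans ((measure_union_le _ _).trans_eq ?_)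
  rw [measure_singleton, zero_add]

/-! ### The Fejér kernel -/

lemma geom_sum_mul_pow_of_mul_eq_one {R : Type*} [CommRing R] {z w : R} (h : z * w = 1) (n : ℕ) :
    (∑ j ∈ Finset.range n, z ^ j) * w ^ n = ∑ k ∈ Finset.range n, w ^ (k + 1) := by
  induction n with
  | zero => simp
  | succ n ih =>
    rw [Finset.sum_range_succ', Finset.sum_range_succ (fun k => w ^ (k + 1)), ← ih]
    have : ∑ k ∈ Finset.range n, z ^ (k + 1) = z * ∑ k ∈ Finset.range n, z ^ k := by
      rw [Finset.mul_sum]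
      exact Finset.sum_congr rfl fun k _ => pow_succ' z k
    rw [this]
    linear_combination (∑ k ∈ Finset.range n, z ^ k) * w ^ n * h

lemma sum_fejer_weights_eq_geom_sum_mul {R : Type*} [CommRing R] {z w : R} (h : z * w = 1)
    (n : ℕ) :
    (n : R) + ∑ k ∈ Finset.range n, ((n : R) - (k + 1)) * (z ^ (k + 1) + w ^ (k + 1)) =
      (∑ j ∈ Finset.range n, z ^ j) * ∑ j ∈ Finset.range n, w ^ j := by
  induction n with
  | zero => simp
  | succ n ih =>
    have hz := geom_sum_mul_pow_of_mul_eq_one h n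
    have hw := geom_sum_mul_pow_of_mul_eq_one (mul_comm z w ▸ h) n
    have h1 : ∑ k ∈ Finset.range n, (((n + 1 : ℕ) : R) - (k + 1)) * (z ^ (k + 1) + w ^ (k + 1)) =
        ∑ k ∈ Finset.range n, ((n : R) - (k + 1)) * (z ^ (k + 1) + w ^ (k + 1)) +
          (∑ k ∈ Finset.range n, z ^ (k + 1) + ∑ k ∈ Finset.range n, w ^ (k + 1)) := by
      rw [← Finset.sum_add_distrib, ← Finset.sum_add_distrib]
      exact Finset.sum_congr rfl fun k _ => by push_cast; ring
    have hzw : z ^ n * w ^ n = 1 := by rw [← mul_pow, h, one_pow]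
    rw [Finset.sum_range_succ, h1, Finset.sum_range_succ _ n, Finset.sum_range_succ _ n]
    push_cast
    linear_combination ih - hz - hw - hzw

lemma sum_Icc_neg_natCast {M : Type*} [AddCommMonoid M] (f : ℤ → M) (n : ℕ) :
    ∑ j ∈ Finset.Icc (-(n : ℤ)) n, f j =
      f 0 + ∑ k ∈ Finset.range n, (f ((k : ℤ) + 1) + f (-((k : ℤ) + 1))) := by
  induction n with
  | zero => simp
  | succ n ih =>
    have : Finset.Icc (-((n + 1 : ℕ) : ℤ)) (n + 1 : ℕ) =
        insert ((n : ℤ) + 1) (insert (-((n : ℤ) + 1)) (Finset.Icc (-(n : ℤ)) n)) := by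
      ext j
      simp only [Finset.mem_insert, Finset.mem_Icc]
      omega
    rw [this, Finset.sum_insert, Finset.sum_insert, ih, Finset.sum_range_succ]
    · abel
    · simp
    · simp only [Finset.mem_insert, Finset.mem_Icc]
      omega

lemma fourier_natCast_eq_pow (k : ℕ) (x : UnitAddCircle) :
    (fourier (k : ℤ) x : ℂ) = fourier 1 x ^ k := by
  induction k with
  | zero => simp
  | succ k ih => rw [pow_succ, ← ih, Nat.cast_succ, fourier_add]

/-- The Fejér kernel is the squared modulus of a geometric sum, which shows its positivity. -/
lemma fejerKernel_eq_normSq {n : ℕ} (hn : n ≠ 0) (x : UnitAddCircle) :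
    fejerKernel n x =
      ((Complex.normSq (∑ j ∈ Finset.range n, (fourier (j : ℤ) x : ℂ)) / n : ℝ) : ℂ) := by
  have hn' : (n : ℂ) ≠ 0 := Nat.cast_ne_zero.2 hn
  set z : ℂ := fourier 1 x with hz
  have hzw : z * starRingEnd ℂ z = 1 := by
    rw [hz, ← fourier_neg, ← fourier_add, add_neg_cancel, fourier_zero]
  have hD : ∑ j ∈ Finset.range n, (fourier (j : ℤ) x : ℂ) = ∑ j ∈ Finset.range n, z ^ j :=
    Finset.sum_congr rfl fun j _ => fourier_natCast_eq_pow j x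
  rw [Complex.ofReal_div, Complex.normSq_eq_conj_mul_self, hD, map_sum, Complex.ofReal_natCast,
    eq_div_iff hn', mul_comm _ (∑ j ∈ Finset.range n, z ^ j)]
  simp only [map_pow]
  rw [← sum_fejer_weights_eq_geom_sum_mul hzw, fejerKernel, sum_Icc_neg_natCast, add_mul,
    Finset.sum_mul]
  congr 1
  · simp
  · refine Finset.sum_congr rfl fun k _ => ?_
    have hk : (fourier ((k : ℤ) + 1) x : ℂ) = z ^ (k + 1) := by
      rw [← fourier_natCast_eq_pow, Nat.cast_succ]
    have h1 : |(k : ℤ) + 1| = k + 1 := abs_of_nonneg (by positivity)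
    rw [fourier_neg, hk, map_pow, abs_neg, h1]
    push_cast
    field_simp

lemma fejerKernel_re_nonneg {n : ℕ} (hn : n ≠ 0) (x : UnitAddCircle) :
    0 ≤ (fejerKernel n x).re := by
  rw [fejerKernel_eq_normSq hn, Complex.ofReal_re]
  exact div_nonneg (Complex.normSq_nonneg _) (Nat.cast_nonneg n)

lemma fejerKernel_neg_re {n : ℕ} (hn : n ≠ 0) (x : UnitAddCircle) :
    (fejerKernel n (-x)).re = (fejerKernel n x).re := by
  have h (j : ℕ) : (fourier (j : ℤ) (-x) : ℂ) = starRingEnd ℂ (fourier (j : ℤ) x) := by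
    rw [← fourier_neg, fourier_apply, fourier_apply, smul_neg, neg_smul]
  rw [fejerKernel_eq_normSq hn, fejerKernel_eq_normSq hn]
  simp only [h]
  rw [← map_sum, Complex.normSq_conj]

lemma continuous_fejerKernel (n : ℕ) : Continuous (fejerKernel n) := by
  unfold fejerKernel
  fun_prop

lemma div_four_le_fejerKernel_re {n : ℕ} (hn : n ≠ 0) {t : ℝ} (ht : |t| ≤ 1 / (6 * n)) :
    (n : ℝ) / 4 ≤ (fejerKernel n (t : UnitAddCircle)).re := by
  have hn' : (0 : ℝ) < n := Nat.cast_pos.2 (Nat.pos_of_ne_zero hn)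
  have hre (j : ℕ) (hj : j < n) : 1 / 2 ≤ (fourier (j : ℤ) (t : UnitAddCircle) : ℂ).re := by
    have : (fourier (j : ℤ) (t : UnitAddCircle) : ℂ) = Complex.exp ((2 * Real.pi * j * t : ℝ) *
        Complex.I) := by
      rw [fourier_coe_apply]
      congr 1
      push_cast
      ring
    rw [this, Complex.exp_ofReal_mul_I_re, ← Real.cos_pi_div_three,
      ← Real.cos_abs (2 * Real.pi * j * t)]
    refine Real.cos_le_cos_of_nonneg_of_le_pi (abs_nonneg _) (by linarith [Real.pi_pos]) ?_
    rw [abs_mul, abs_of_nonneg (by positivity : (0 : ℝ) ≤ 2 * Real.pi * j)]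
    have hjn : (j : ℝ) ≤ n := by exact_mod_cast hj.le
    calc 2 * Real.pi * j * |t| ≤ 2 * Real.pi * n * (1 / (6 * n)) := by
          have := Real.pi_pos
          gcongr
      _ = Real.pi / 3 := by field_simp; norm_num
  have hD : (n : ℝ) / 2 ≤ (∑ j ∈ Finset.range n, (fourier (j : ℤ) (t : UnitAddCircle) : ℂ)).re := by
    rw [Complex.re_sum]
    calc (n : ℝ) / 2 = ∑ j ∈ Finset.range n, (1 / 2 : ℝ) := by simp; ring
      _ ≤ _ := Finset.sum_le_sum fun j hj => hre j (Finset.mem_range.1 hj)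
  rw [fejerKernel_eq_normSq hn, Complex.ofReal_re, le_div_iff₀ hn', Complex.normSq_apply]
  nlinarith [mul_self_nonneg
    (∑ j ∈ Finset.range n, (fourier (j : ℤ) (t : UnitAddCircle) : ℂ)).im]

lemma integral_fourier_of_ne_zero {j : ℤ} (hj : j ≠ 0) :
    ∫ x : UnitAddCircle, (fourier j x : ℂ) = 0 :=
  integral_eq_zero_of_add_right_eq_neg (fourier_add_half_inv_index hj one_pos)

lemma integrable_of_continuous_circle {E : Type*} [NormedAddCommGroup E] {f : UnitAddCircle → E}
    (hf : Continuous f) : Integrable f :=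
  hf.integrable_of_hasCompactSupport (HasCompactSupport.of_compactSpace f)

lemma integral_fejerKernel (n : ℕ) : ∫ x, fejerKernel n x = 1 := by
  unfold fejerKernel
  rw [integral_finsetSum _ fun j _ => integrable_of_continuous_circle (by fun_prop),
    Finset.sum_eq_single 0]
  · simp [measureReal_def]
  · intro j _ hj
    rw [integral_const_mul, integral_fourier_of_ne_zero hj, mul_zero]
  · intro h
    simp at h

lemma lintegral_fejerKernel {n : ℕ} (hn : n ≠ 0) :
    ∫⁻ x, ENNReal.ofReal (fejerKernel n x).re = 1 := by
  have hi := integrable_of_continuous_circle (continuous_fejerKernel n)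
  have h := ofReal_integral_eq_lintegral_ofReal hi.re (ae_of_all _ (fejerKernel_re_nonneg hn))
  simp only [RCLike.re_eq_complex_re] at h
  have hre := integral_re hi
  simp only [RCLike.re_eq_complex_re] at hre
  rw [← h, hre, integral_fejerKernel]
  simp

/-! ### The lacunary sum of Fejér kernels -/

lemma measurable_lacunaryFejer_term (N : ℕ → ℕ) (m : ℕ) :
    Measurable fun x : UnitAddCircle => ENNReal.ofReal
      ((fejerKernel (3 ^ 2 ^ (m + 1)) (N (m + 1) • x)).re / ((m + 1 : ℕ) : ℝ) ^ 2) := by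
  refine ENNReal.measurable_ofReal.comp (Continuous.measurable ?_)
  exact (Complex.continuous_re.comp ((continuous_fejerKernel _).comp
    (continuous_nsmul _))).div_const _

lemma measurable_lacunaryFejer (N : ℕ → ℕ) : Measurable (lacunaryFejer N) :=
  Measurable.tsum (measurable_lacunaryFejer_term N)

lemma lacunaryFejer_neg (N : ℕ → ℕ) (x : UnitAddCircle) :
    lacunaryFejer N (-x) = lacunaryFejer N x := by
  refine tsum_congr fun m => ?_
  rw [smul_neg, fejerKernel_neg_re (by positivity)]

lemma lintegral_lacunaryFejer_ne_top {N : ℕ → ℕ} (hN : ∀ m, 1 ≤ m → 1 < N m) :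
    ∫⁻ x, lacunaryFejer N x ≠ ∞ := by
  unfold lacunaryFejer
  rw [lintegral_tsum fun m => (measurable_lacunaryFejer_term N m).aemeasurable]
  have h (m : ℕ) : ∫⁻ x : UnitAddCircle, ENNReal.ofReal
      ((fejerKernel (3 ^ 2 ^ (m + 1)) (N (m + 1) • x)).re / ((m + 1 : ℕ) : ℝ) ^ 2) =
      ENNReal.ofReal (1 / ((m + 1 : ℕ) : ℝ) ^ 2) := by
    have hmp := (AddCircle.ergodic_nsmul (T := 1) (hN (m + 1) (by omega))).toMeasurePreserving
    have hm : Measurable fun x : UnitAddCircle =>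
        ENNReal.ofReal (fejerKernel (3 ^ 2 ^ (m + 1)) x).re :=
      ENNReal.measurable_ofReal.comp
        (Complex.continuous_re.comp (continuous_fejerKernel _)).measurable
    have h1 := hmp.lintegral_comp hm
    rw [lintegral_fejerKernel (by positivity)] at h1
    have (x : UnitAddCircle) : ENNReal.ofReal
        ((fejerKernel (3 ^ 2 ^ (m + 1)) (N (m + 1) • x)).re / ((m + 1 : ℕ) : ℝ) ^ 2) =
        ENNReal.ofReal (fejerKernel (3 ^ 2 ^ (m + 1)) (N (m + 1) • x)).re *
          ENNReal.ofReal (1 / ((m + 1 : ℕ) : ℝ) ^ 2) := by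
      rw [← ENNReal.ofReal_mul (fejerKernel_re_nonneg (by positivity) _), mul_one_div]
    simp only [this]
    rw [lintegral_mul_const' _ _ ENNReal.ofReal_ne_top, h1, one_mul]
  simp only [h]
  have hs : Summable fun m : ℕ => 1 / ((m + 1 : ℕ) : ℝ) ^ 2 :=
    (summable_nat_add_iff 1).2 (Real.summable_one_div_nat_pow.2 one_lt_two)
  exact hs.tsum_ofReal_ne_top

/-! ### Concentration near the Cantor set -/

/-- The left end points of the `2 ^ n` intervals of the `n`-th step of the construction of the
Cantor set. -/
noncomputable def cantorPoints : ℕ → Finset ℝ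
  | 0 => {0}
  | n + 1 => (cantorPoints n).image (fun x => x / 3) ∪
      (cantorPoints n).image fun x => (x + 2) / 3

lemma card_cantorPoints_le (n : ℕ) : (cantorPoints n).card ≤ 2 ^ n := by
  induction n with
  | zero => simp [cantorPoints]
  | succ n ih =>
    rw [cantorPoints, pow_succ, mul_two]
    exact (Finset.card_union_le _ _).trans (add_le_add (Finset.card_image_le.trans ih)
      (Finset.card_image_le.trans ih))

lemma exists_mem_cantorPoints (n : ℕ) (ε : ℕ → Bool) :
    ∃ c ∈ cantorPoints n, |cantorCoding ε - c| ≤ 1 / 3 ^ n := by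
  induction n generalizing ε with
  | zero =>
    refine ⟨0, by simp [cantorPoints], ?_⟩
    have := cantorCoding_mem_Icc ε
    rw [abs_le]
    constructor <;> norm_num <;> linarith [this.1, this.2]
  | succ n ih =>
    obtain ⟨c, hc, h⟩ := ih fun k => ε (k + 1)
    refine ⟨(c + if ε 0 then 2 else 0) / 3, ?_, ?_⟩
    · rw [cantorPoints, Finset.mem_union, Finset.mem_image, Finset.mem_image]
      cases ε 0
      · exact Or.inl ⟨c, hc, by simp⟩
      · exact Or.inr ⟨c, hc, by simp⟩
    · rw [← consBit_head_tail ε, cantorCoding_consBit, ← sub_div, abs_div, consBit,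
        add_sub_add_right_eq_sub, abs_of_pos (three_pos : (0 : ℝ) < 3), pow_succ,
        ← div_div]
      gcongr

/-- A neighbourhood of the Cantor set in the circle, a union of `2 ^ n` balls of radius
`2 / 3 ^ n`. -/
noncomputable def cantorNhd (n : ℕ) : Set UnitAddCircle :=
  ⋃ c ∈ cantorPoints n, Metric.closedBall (c : UnitAddCircle) (2 / 3 ^ n)

lemma measurableSet_cantorNhd (n : ℕ) : MeasurableSet (cantorNhd n) :=
  Finset.measurableSet_biUnion _ fun _ _ => measurableSet_closedBall

lemma volume_cantorNhd_le (n : ℕ) : volume (cantorNhd n) ≤ ENNReal.ofReal (4 * (2 / 3) ^ n) := by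
  calc volume (cantorNhd n)
      ≤ ∑ c ∈ cantorPoints n, volume (Metric.closedBall (c : UnitAddCircle) (2 / 3 ^ n)) :=
        measure_biUnion_finset_le _ _
    _ ≤ ∑ c ∈ cantorPoints n, ENNReal.ofReal (4 / 3 ^ n) := by
        refine Finset.sum_le_sum fun c _ => ?_
        rw [AddCircle.volume_closedBall]
        refine ENNReal.ofReal_le_ofReal ((min_le_right _ _).trans_eq (by ring))
    _ ≤ (2 ^ n : ℕ) * ENNReal.ofReal (4 / 3 ^ n) := by
        rw [Finset.sum_const, nsmul_eq_mul]
        gcongr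
        exact card_cantorPoints_le n
    _ = ENNReal.ofReal (4 * (2 / 3) ^ n) := by
        rw [← ENNReal.ofReal_natCast, ← ENNReal.ofReal_mul (by positivity)]
        congr 1
        rw [div_pow]
        push_cast
        ring

lemma circleCantor_translate_cantorNhd {n : ℕ} {x : UnitAddCircle} (hx : ‖x‖ ≤ 1 / 3 ^ n) :
    circleCantor ((fun y => x + y) ⁻¹' cantorNhd n) = 1 := by
  have hm : MeasurableSet ((fun y => x + y) ⁻¹' cantorNhd n) :=
    measurable_const_add x (measurableSet_cantorNhd n)
  rw [circleCantor_apply hm, cantorMeasure_eq_map,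
    Measure.map_apply measurable_cantorCoding (AddCircle.measurable_mk' hm)]
  convert measure_univ (μ := bitMeasure)
  refine eq_univ_of_forall fun ε => ?_
  obtain ⟨c, hc, h⟩ := exists_mem_cantorPoints n ε
  simp only [mem_preimage, cantorNhd, mem_iUnion, Metric.mem_closedBall]
  refine ⟨c, hc, ?_⟩
  have h' : ‖((cantorCoding ε - c : ℝ) : UnitAddCircle)‖ ≤ 1 / 3 ^ n := by
    rw [UnitAddCircle.norm_eq]
    exact ((round_le _ 0).trans_eq (by simp)).trans h
  rw [dist_eq_norm, add_sub_assoc, ← AddCircle.coe_sub]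
  refine (norm_add_le _ _).trans ((add_le_add hx h').trans_eq ?_)
  ring

/-- The part of the convolution that comes from the Fejér kernel of index `m + 1` has mass of order
`(m + 1)⁻²` on the preimage of a neighbourhood of the Cantor set under the expansion by `N_{m+1}`.
This expansion preserves both Lebesgue measure and the Cantor measure, and turns that part into the
convolution of an approximate identity with the Cantor measure. -/
lemma le_fejerCantorCircle_preimage_cantorNhd {N : ℕ → ℕ} (m : ℕ) {k : ℕ} (hk : 1 ≤ k)
    (hNk : N (m + 1) = 3 ^ k) :
    ENNReal.ofReal (1 / (12 * ((m + 1 : ℕ) : ℝ) ^ 2)) ≤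
      fejerCantorCircle N ((fun x => N (m + 1) • x) ⁻¹' cantorNhd (2 ^ (m + 1))) := by
  set F := cantorNhd (2 ^ (m + 1)) with hFdef
  have hF : MeasurableSet F := measurableSet_cantorNhd _
  set n : ℕ := 3 ^ 2 ^ (m + 1) with hn
  have hn0 : n ≠ 0 := by positivity
  have hnR : (0 : ℝ) < n := Nat.cast_pos.2 (Nat.pos_of_ne_zero hn0)
  have hncast : (n : ℝ) = 3 ^ 2 ^ (m + 1) := by rw [hn]; push_cast; rfl
  have hmR : (0 : ℝ) < ((m + 1 : ℕ) : ℝ) ^ 2 := by positivity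
  have hT : Measurable fun x : UnitAddCircle => N (m + 1) • x := (continuous_nsmul _).measurable
  have hE : MeasurableSet ((fun x : UnitAddCircle => N (m + 1) • x) ⁻¹' F) := hT hF
  have hmp := (AddCircle.ergodic_nsmul (T := 1) (n := N (m + 1))
    (by rw [hNk]; exact Nat.one_lt_pow (by omega) (by norm_num))).toMeasurePreserving
  have hH (A : Set UnitAddCircle) (hA : MeasurableSet A) :
      Measurable fun x => circleCantor ((fun y => x + y) ⁻¹' A) :=
    measurable_measure_prodMk_left (measurable_add hA)
  set φ : UnitAddCircle → ℝ≥0∞ := fun x =>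
    ENNReal.ofReal ((fejerKernel n x).re / ((m + 1 : ℕ) : ℝ) ^ 2) *
      circleCantor ((fun y => x + y) ⁻¹' F) with hφ
  have hφm : Measurable φ := by
    refine (ENNReal.measurable_ofReal.comp ?_).mul (hH F hF)
    exact ((Complex.continuous_re.comp (continuous_fejerKernel n)).div_const _).measurable
  have hshift (x : UnitAddCircle) : circleCantor ((fun y => x + y) ⁻¹'
      ((fun x => N (m + 1) • x) ⁻¹' F)) =
      circleCantor ((fun y => N (m + 1) • x + y) ⁻¹' F) := by
    have h3 := measurePreserving_three_pow_nsmul_circleCantor k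
    rw [← h3.measure_preimage
      (measurable_const_add (N (m + 1) • x) hF).nullMeasurableSet, hNk]
    congr 1
    ext y
    simp only [mem_preimage, smul_add]
  calc ENNReal.ofReal (1 / (12 * ((m + 1 : ℕ) : ℝ) ^ 2))
      = ENNReal.ofReal (n / 4 / ((m + 1 : ℕ) : ℝ) ^ 2) *
          volume (Metric.closedBall (0 : UnitAddCircle) (1 / (6 * n))) := by
        have h1 : (1 : ℝ) ≤ n := by exact_mod_cast Nat.one_le_iff_ne_zero.2 hn0
        have : min 1 (2 * (1 / (6 * (n : ℝ)))) = 1 / (3 * n) := by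
          rw [min_eq_right]
          · field_simp; norm_num
          · rw [← mul_div_assoc, mul_one, div_le_one (by positivity)]
            linarith
        rw [AddCircle.volume_closedBall, this, ← ENNReal.ofReal_mul (by positivity)]
        congr 1
        field_simp
        norm_num
    _ = ∫⁻ _ in Metric.closedBall (0 : UnitAddCircle) (1 / (6 * n)),
          ENNReal.ofReal (n / 4 / ((m + 1 : ℕ) : ℝ) ^ 2) := by
        rw [setLIntegral_const]
    _ ≤ ∫⁻ x in Metric.closedBall (0 : UnitAddCircle) (1 / (6 * n)), φ x := by
        refine setLIntegral_mono hφm fun x hx => ?_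
        rw [mem_closedBall_zero_iff] at hx
        obtain ⟨t, rfl, ht⟩ : ∃ t : ℝ, (t : UnitAddCircle) = x ∧ |t| = ‖x‖ := by
          refine ⟨icoRep x - round (icoRep x), ?_, ?_⟩
          · rw [AddCircle.coe_sub, coe_icoRep, sub_eq_self]
            exact (AddCircle.coe_eq_zero_iff _).2 ⟨round (icoRep x), by simp⟩
          · conv_rhs => rw [← coe_icoRep x, UnitAddCircle.norm_eq]
        have hx' : ‖(t : UnitAddCircle)‖ ≤ 1 / 3 ^ 2 ^ (m + 1) := by
          refine hx.trans ?_
          rw [← hncast]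
          gcongr
          linarith
        rw [hφ]
        simp only
        rw [circleCantor_translate_cantorNhd hx', mul_one]
        gcongr
        exact div_four_le_fejerKernel_re hn0 (ht.le.trans hx)
    _ ≤ ∫⁻ x, φ x := setLIntegral_le_lintegral _ _
    _ = ∫⁻ x, φ (N (m + 1) • x) := (hmp.lintegral_comp hφm).symm
    _ ≤ ∫⁻ x, lacunaryFejer N x * circleCantor ((fun y => x + y) ⁻¹'
          ((fun x => N (m + 1) • x) ⁻¹' F)) := by
        refine lintegral_mono fun x => ?_
        simp only [hshift, hφ]
        gcongr
        exact ENNReal.le_tsum (f := fun m : ℕ => ENNReal.ofReal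
          ((fejerKernel (3 ^ 2 ^ (m + 1)) (N (m + 1) • x)).re / ((m + 1 : ℕ) : ℝ) ^ 2)) m
    _ = fejerCantorCircle N ((fun x => N (m + 1) • x) ⁻¹' F) := by
        change _ = (volume.withDensity (lacunaryFejer N)).conv circleCantor _
        rw [conv_apply _ _ hE,
          lintegral_withDensity_eq_lintegral_mul _ (measurable_lacunaryFejer N) (hH _ hE)]
        rfl

/-! ### The convolution on the line -/

lemma fejerCantor_eq_map (N : ℕ → ℕ) : fejerCantor N = (fejerCantorCircle N).map icoRep := rfl

lemma fejerCantorCircle_eq_conv (N : ℕ → ℕ) :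
    fejerCantorCircle N = (volume.withDensity (lacunaryFejer N)).conv circleCantor := rfl

lemma conv_absolutelyContinuous_volume {μ : Measure UnitAddCircle} (hμ : μ ≪ volume)
    (ν : Measure UnitAddCircle) [SFinite μ] [SFinite ν] : μ.conv ν ≪ volume := by
  refine Measure.AbsolutelyContinuous.mk fun A hA hA0 => ?_
  rw [Measure.conv_comm, conv_apply _ _ hA]
  refine (lintegral_eq_zero_of_ae_eq_zero (ae_of_all _ fun x => hμ ?_))
  rw [measure_preimage_add, hA0]

lemma volume_circle_singleton (x : UnitAddCircle) : volume ({x} : Set UnitAddCircle) = 0 := by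
  rw [← Metric.closedBall_zero, AddCircle.volume_closedBall]
  simp

lemma fejerCantorCircle_absolutelyContinuous (N : ℕ → ℕ) : fejerCantorCircle N ≪ volume :=
  conv_absolutelyContinuous_volume (withDensity_absolutelyContinuous _ _) _

lemma map_neg_fejerCantorCircle (N : ℕ → ℕ) :
    (fejerCantorCircle N).map (fun x => -x) = fejerCantorCircle N := by
  have hneg : (volume : Measure UnitAddCircle).map (fun x => -x) = volume :=
    Measure.map_neg_eq_self _
  ext A hA
  have hH (A : Set UnitAddCircle) (hA : MeasurableSet A) :
      Measurable fun x => circleCantor ((fun y => x + y) ⁻¹' A) :=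
    measurable_measure_prodMk_left (measurable_add hA)
  have hA' : MeasurableSet ((fun x : UnitAddCircle => -x) ⁻¹' A) := measurable_neg hA
  have hφ := (measurable_lacunaryFejer N).mul (hH A hA)
  rw [Measure.map_apply measurable_neg hA, fejerCantorCircle_eq_conv, conv_apply _ _ hA',
    conv_apply _ _ hA, lintegral_withDensity_eq_lintegral_mul _ (measurable_lacunaryFejer N)
      (hH _ hA'), lintegral_withDensity_eq_lintegral_mul _ (measurable_lacunaryFejer N) (hH _ hA)]
  conv_rhs => rw [← hneg, lintegral_map hφ measurable_neg]
  refine lintegral_congr fun x => ?_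
  simp only [Pi.mul_apply, lacunaryFejer_neg]
  congr 1
  conv_rhs => rw [← map_neg_circleCantor,
    Measure.map_apply measurable_neg (measurable_const_add _ hA)]
  congr 1
  ext y
  simp [add_comm]

lemma isFiniteMeasure_fejerCantor {N : ℕ → ℕ} (hN : ∀ m, 1 ≤ m → 1 < N m) :
    IsFiniteMeasure (fejerCantor N) := by
  have := isFiniteMeasure_withDensity (lintegral_lacunaryFejer_ne_top hN)
  rw [fejerCantor_eq_map, fejerCantorCircle_eq_conv]
  infer_instance

lemma fejerCantor_ball_reverse_doubling (N : ℕ → ℕ) {s r : ℝ} (hs : s ∈ Icc (0 : ℝ) 1)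
    (hr0 : 0 < r) (hr : r ≤ 1 / 162) :
    2 * fejerCantor N (Metric.ball s r) ≤ fejerCantor N (Metric.ball s (600 * r)) := by
  have h1 := map_icoRep_ball_le (fejerCantorCircle N) s r
  have h2 := conv_circleCantor_ball_reverse_doubling (volume.withDensity (lacunaryFejer N))
    (s : UnitAddCircle) hr0 hr
  have h3 := ball_le_two_mul_map_icoRep (fejerCantorCircle N)
    (fejerCantorCircle_absolutelyContinuous N (volume_circle_singleton 0))
    (map_neg_fejerCantorCircle N) hs (600 * r)
  rw [← fejerCantorCircle_eq_conv] at h2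
  rw [← fejerCantor_eq_map] at h1 h3
  have h4 : 8 * (2 * fejerCantor N (Metric.ball s r)) ≤
      8 * fejerCantor N (Metric.ball s (600 * r)) := by
    calc 8 * (2 * fejerCantor N (Metric.ball s r))
        = 16 * fejerCantor N (Metric.ball s r) := by rw [← mul_assoc]; norm_num
      _ ≤ 16 * fejerCantorCircle N (Metric.ball (s : UnitAddCircle) r) := by gcongr
      _ ≤ 3 * fejerCantorCircle N (Metric.ball (s : UnitAddCircle) (600 * r)) := h2
      _ ≤ 3 * (2 * fejerCantor N (Metric.ball s (600 * r))) := by gcongr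
      _ = 6 * fejerCantor N (Metric.ball s (600 * r)) := by rw [← mul_assoc]; norm_num
      _ ≤ _ := by gcongr; norm_num
  exact (ENNReal.mul_le_mul_iff_right (by norm_num) (by norm_num)).1 h4

lemma fejerCantor_compl_Icc (N : ℕ → ℕ) : fejerCantor N (Icc (0 : ℝ) 1)ᶜ = 0 := by
  rw [fejerCantor_eq_map, Measure.map_apply measurable_icoRep measurableSet_Icc.compl]
  convert measure_empty (μ := fejerCantorCircle N)
  refine eq_empty_of_forall_notMem fun x hx => hx ?_
  exact Ico_subset_Icc_self (icoRep_mem x)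

/-! ### Failure of higher integrability -/

/-- Hölder's inequality for the mass that an `L^p` density gives to a set. -/
lemma withDensity_apply_le_eLpNorm_mul_rpow {X : Type*} [MeasurableSpace X] {μ : Measure X}
    {f : X → ℝ} (hf : Measurable f) (hf0 : ∀ x, 0 ≤ f x) {p : ℝ≥0∞} (hp : 1 ≤ p) {E : Set X}
    (hE : MeasurableSet E) :
    μ.withDensity (fun x => ENNReal.ofReal (f x)) E ≤
      eLpNorm f p μ * μ E ^ (1 - 1 / p.toReal) := by
  have h := eLpNorm_le_eLpNorm_mul_rpow_measure_univ (μ := μ.restrict E) hp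
    hf.aestronglyMeasurable
  rw [Measure.restrict_apply_univ, ENNReal.toReal_one, div_one] at h
  calc μ.withDensity (fun x => ENNReal.ofReal (f x)) E
      = eLpNorm f 1 (μ.restrict E) := by
        rw [withDensity_apply _ hE, eLpNorm_one_eq_lintegral_enorm]
        refine lintegral_congr fun x => ?_
        rw [Real.enorm_eq_ofReal (hf0 x)]
    _ ≤ _ := h
    _ ≤ _ := by gcongr; exact Measure.restrict_le_self

lemma one_sub_one_div_toReal_pos {p : ℝ≥0∞} (hp : 1 < p) : 0 < 1 - 1 / p.toReal := by
  rcases eq_or_ne p ∞ with rfl | hp'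
  · simp
  · have : 1 < p.toReal := by
      rw [← ENNReal.toReal_one]
      exact ENNReal.toReal_strict_mono hp' hp
    rw [sub_pos, div_lt_one (by linarith)]
    exact this

/-- A density is in no `L^p` with `p > 1` if its measure has mass of order at least `m⁻²` on sets
whose Lebesgue measure is exponentially small in `m`. -/
lemma not_memLp_of_concentrated {X : Type*} [MeasurableSpace X] {μ : Measure X} {f : X → ℝ}
    (hf : Measurable f) (hf0 : ∀ x, 0 ≤ f x) {E : ℕ → Set X} (hE : ∀ m, MeasurableSet (E m))
    {c : ℝ} (hc : 0 < c) (hμ : ∀ m, μ (E m) ≤ ENNReal.ofReal (4 * (2 / 3) ^ (m + 1)))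
    (hν : ∀ m : ℕ, ENNReal.ofReal (c / ((m + 1 : ℕ) : ℝ) ^ 2) ≤
      μ.withDensity (fun x => ENNReal.ofReal (f x)) (E m))
    {p : ℝ≥0∞} (hp : 1 < p) : ¬ MemLp f p μ := by
  intro hfp
  have hβ := one_sub_one_div_toReal_pos hp
  set β := 1 - 1 / p.toReal
  set C := (eLpNorm f p μ).toReal
  have key (m : ℕ) : c ≤ C * 4 ^ β *
      (((m + 1 : ℕ) : ℝ) ^ 2 * (((2 / 3 : ℝ) ^ β) ^ (m + 1))) := by
    have h1 : ENNReal.ofReal (c / ((m + 1 : ℕ) : ℝ) ^ 2) ≤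
        ENNReal.ofReal (C * (4 * (2 / 3) ^ (m + 1)) ^ β) := by
      calc _ ≤ _ := hν m
        _ ≤ eLpNorm f p μ * μ (E m) ^ β :=
          withDensity_apply_le_eLpNorm_mul_rpow hf hf0 hp.le (hE m)
        _ ≤ eLpNorm f p μ * ENNReal.ofReal (4 * (2 / 3) ^ (m + 1)) ^ β := by
          gcongr
          exact hμ m
        _ = _ := by
          rw [ENNReal.ofReal_rpow_of_nonneg (by positivity) hβ.le, ENNReal.ofReal_mul
            ENNReal.toReal_nonneg, ENNReal.ofReal_toReal hfp.eLpNorm_ne_top]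
    have h2 := (ENNReal.ofReal_le_ofReal_iff
      (mul_nonneg ENNReal.toReal_nonneg (by positivity))).1 h1
    rw [div_le_iff₀ (by positivity), Real.mul_rpow (by norm_num) (by positivity),
      ← Real.rpow_pow_comm (by norm_num)] at h2
    linarith
  have hρ0 : 0 ≤ (2 / 3 : ℝ) ^ β := by positivity
  have hρ1 : (2 / 3 : ℝ) ^ β < 1 := Real.rpow_lt_one (by norm_num) (by norm_num) hβ
  have hlim := (((tendsto_pow_const_mul_const_pow_of_lt_one 2 hρ0 hρ1).comp
    (Filter.tendsto_add_atTop_nat 1)).const_mul (C * 4 ^ β))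
  rw [mul_zero] at hlim
  exact absurd (ge_of_tendsto' hlim key) (not_le.2 hc)

/-! ### The example -/

lemma isLacunarySeq_three_pow : IsLacunarySeq fun m => 3 ^ (2 ^ m + m - 2) := by
  refine ⟨rfl, fun m hm => ⟨_, ?_, rfl⟩, fun m hm => ?_⟩
  · have : m < 2 ^ m := Nat.lt_two_pow_self
    omega
  · have : m < 2 ^ m := Nat.lt_two_pow_self
    rw [← pow_add]
    refine Nat.pow_lt_pow_right (by norm_num) ?_
    rw [pow_succ]
    omega

lemma IsLacunarySeq.one_lt {N : ℕ → ℕ} (hN : IsLacunarySeq N) (m : ℕ) (hm : 1 ≤ m) : 1 < N m := by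
  obtain ⟨k, hk, h⟩ := hN.2.1 m hm
  rw [h]
  exact Nat.one_lt_pow (by omega) (by norm_num)

/-- A subset of `[0, 1)` of small Lebesgue measure on which the Fejér kernel of index `m + 1` (the
indices of the sequence `N` start at `1`) concentrates a part of the convolution. -/
noncomputable def concentrationSet (N : ℕ → ℕ) (m : ℕ) : Set ℝ :=
  Ico 0 1 ∩ (fun t : ℝ => (t : UnitAddCircle)) ⁻¹'
    ((fun x => N (m + 1) • x) ⁻¹' cantorNhd (2 ^ (m + 1)))

lemma measurableSet_expansion_preimage (N : ℕ → ℕ) (m : ℕ) :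
    MeasurableSet ((fun x : UnitAddCircle => N (m + 1) • x) ⁻¹' cantorNhd (2 ^ (m + 1))) :=
  (continuous_nsmul _).measurable (measurableSet_cantorNhd _)

lemma measurableSet_concentrationSet (N : ℕ → ℕ) (m : ℕ) :
    MeasurableSet (concentrationSet N m) :=
  measurableSet_Ico.inter (AddCircle.measurable_mk' (measurableSet_expansion_preimage N m))

lemma volume_concentrationSet_le {N : ℕ → ℕ} (hN : IsLacunarySeq N) (m : ℕ) :
    volume (concentrationSet N m) ≤ ENNReal.ofReal (4 * (2 / 3) ^ (m + 1)) := by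
  have hmp := (AddCircle.ergodic_nsmul (T := 1)
    (hN.one_lt (m + 1) (by omega))).toMeasurePreserving
  refine (volume_Ico_inter_coe_preimage_le (measurableSet_expansion_preimage N m)).trans ?_
  rw [hmp.measure_preimage (measurableSet_cantorNhd _).nullMeasurableSet]
  refine (volume_cantorNhd_le _).trans (ENNReal.ofReal_le_ofReal ?_)
  gcongr 4 * ?_
  exact pow_le_pow_of_le_one (by norm_num) (by norm_num) Nat.lt_two_pow_self.le

lemma le_fejerCantor_concentrationSet {N : ℕ → ℕ} (hN : IsLacunarySeq N) (m : ℕ) :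
    ENNReal.ofReal (1 / (12 * ((m + 1 : ℕ) : ℝ) ^ 2)) ≤ fejerCantor N (concentrationSet N m) := by
  obtain ⟨k, hk, hNk⟩ := hN.2.1 (m + 1) (by omega)
  refine (le_fejerCantorCircle_preimage_cantorNhd m hk hNk).trans_eq ?_
  rw [fejerCantor_eq_map, Measure.map_apply measurable_icoRep (measurableSet_concentrationSet N m)]
  congr 1
  ext x
  rw [concentrationSet, mem_preimage (f := icoRep), mem_inter_iff,
    mem_preimage (f := fun t : ℝ => (t : UnitAddCircle)), coe_icoRep]
  simp [icoRep_mem x]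

theorem mainTheorem6 :
    ∃ (ν : Measure ℝ) (f : ℝ → ℝ) (N : ℕ → ℕ),
      IsProbabilityMeasure ν ∧ ν (Icc (0 : ℝ) 1)ᶜ = 0 ∧
      -- absolute continuity, with density `f`
      ν ≪ volume ∧ Measurable f ∧ (∀ x, 0 ≤ f x) ∧
      ν = volume.withDensity (fun x => ENNReal.ofReal (f x)) ∧
      -- positive lower Assouad dimension and uniform perfectness
      0 < lowerAssouadDim ν ∧ IsUniformlyPerfectOn ν (Icc (0 : ℝ) 1) ∧
      -- the density is in no `L^p` with `p > 1`
      (∀ p : ℝ≥0∞, 1 < p → ¬ MemLp f p volume) ∧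
      -- `ν` is the normalized circle convolution of the lacunary Fejér sum and the Cantor measure
      IsLacunarySeq N ∧ ν = (fejerCantor N univ)⁻¹ • fejerCantor N := by
  set N : ℕ → ℕ := fun m => 3 ^ (2 ^ m + m - 2)
  have hN : IsLacunarySeq N := isLacunarySeq_three_pow
  have := isFiniteMeasure_fejerCantor hN.one_lt
  have htop : fejerCantor N univ ≠ ∞ := measure_ne_top _ _
  have hzero : fejerCantor N univ ≠ 0 := fun h => by
    have := (le_fejerCantor_concentrationSet hN 0).trans (measure_mono (subset_univ _))
    rw [h, nonpos_iff_eq_zero, ENNReal.ofReal_eq_zero] at this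
    norm_num at this
  have : NeZero (fejerCantor N) := ⟨fun h => hzero (by simp [h])⟩
  set ν : Measure ℝ := (fejerCantor N univ)⁻¹ • fejerCantor N with hν
  have hprob : IsProbabilityMeasure ν := isProbabilityMeasureSMul
  have hac : ν ≪ volume :=
    (map_icoRep_absolutelyContinuous (fejerCantorCircle_absolutelyContinuous N)).smul_left _
  have hcompl : ν (Icc (0 : ℝ) 1)ᶜ = 0 := by
    rw [hν, Measure.smul_apply, fejerCantor_compl_Icc, smul_zero]
  have hsupp : ν.support ⊆ Icc (0 : ℝ) 1 :=
    Measure.support_subset_of_isClosed isClosed_Icc (mem_ae_iff.2 hcompl)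
  have hdoubling : ∀ x ∈ ν.support, ∀ r : ℝ, 0 < r → r ≤ 1 / 162 →
      2 * ν.real (Metric.ball x r) ≤ ν.real (Metric.ball x (600 * r)) := by
    intro x hx r hr0 hr
    have h : 2 * ν (Metric.ball x r) ≤ ν (Metric.ball x (600 * r)) := by
      rw [hν, Measure.smul_apply, Measure.smul_apply, smul_eq_mul, smul_eq_mul, mul_left_comm]
      gcongr
      exact fejerCantor_ball_reverse_doubling N (hsupp hx) hr0 hr
    have := ENNReal.toReal_mono (measure_ne_top _ _) h
    rwa [ENNReal.toReal_mul] at this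
  set f : ℝ → ℝ := fun x => (ν.rnDeriv volume x).toReal
  have hf : Measurable f := (Measure.measurable_rnDeriv _ _).ennreal_toReal
  have hf0 : ∀ x, 0 ≤ f x := fun _ => ENNReal.toReal_nonneg
  have hdens : ν = volume.withDensity fun x => ENNReal.ofReal (f x) := by
    conv_lhs => rw [← Measure.withDensity_rnDeriv_eq ν volume hac]
    refine withDensity_congr_ae ?_
    filter_upwards [Measure.rnDeriv_lt_top ν volume] with x hx
    exact (ENNReal.ofReal_toReal hx.ne).symm
  refine ⟨ν, f, N, hprob, hcompl, hac, hf, hf0, hdens,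
    lowerAssouadDim_pos (by norm_num) (by norm_num) hdoubling,
    isUniformlyPerfectOn_of_reverse_doubling (by norm_num) (by norm_num) hdoubling _, ?_, hN, hν⟩
  intro p hp
  have hc : 0 < ((fejerCantor N univ)⁻¹).toReal / 12 :=
    div_pos (ENNReal.toReal_pos (ENNReal.inv_ne_zero.2 htop) (ENNReal.inv_ne_top.2 hzero))
      (by norm_num)
  refine not_memLp_of_concentrated hf hf0 (measurableSet_concentrationSet N) hc
    (volume_concentrationSet_le hN) (fun m => ?_) hp
  rw [← hdens, hν, Measure.smul_apply, smul_eq_mul]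
  refine le_trans (le_of_eq ?_) (mul_le_mul_right (le_fejerCantor_concentrationSet hN m) _)
  rw [← ENNReal.ofReal_toReal (ENNReal.inv_ne_top.2 hzero),
    ← ENNReal.ofReal_mul ENNReal.toReal_nonneg, ENNReal.toReal_ofReal ENNReal.toReal_nonneg]
  congr 1
  field_simp
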